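/- **Setting.** Let $\Omega\subset\mathbb R^3$ be a bounded domain, $W^0=W^3=L^2(\Omega)$, $W^1=W^2=L^2(\Omega)^3$, with $L^2$ inner product $\langle\cdot,\cdot\rangle$ and norm $\|\cdot\|$. Let $V^0\to V^1\to V^2\to V^3=W^3$ be a de Rham complex on $\Omega$: $d^0,d^1,d^2$ are the weak gradient, curl and divergence restricted to domains $V^k\subset W^k$ that contain $C_c^\infty(\Omega)$, the operators $d^k$ with domain $V^k$ are closed and densely defined, $dV^k\subset V^{k+1}$ and $d\circ d=0$; put $d^3=0$ (the choice of the $V^k$ encodes the boundary conditions). Let $V^*_k$ be the domain of the adjoint $d^*$ of $d^{k-1}$, and assume that the inclusions $V^k\cap V_k^*\subset W^k$, with the norm $\|w\|+\|dw\|+\|d^*w\|$, are compact for $k=1,2,3$. Write $\|v\|_{V}=\|v\|+\|dv\|$, $\mathfrak Z^k=\ker d^k$, $\mathfrak B^k=dV^{k-1}$, $\mathfrak H^k=\mathfrak Z^k\cap(\mathfrak B^k)^\perp$, and let $P_{\mathfrak B}$ be the $L^2$-orthogonal projection onto $\mathfrak B^k$. Let $c_p$ be the best constant with $\|z\|_V\le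 c_p\|dz\|$ for all $z\in V^k\cap(\mathfrak Z^k)^\perp$, $k=1,2$. Let $V_h^k\subset V^k$ ($k=1,2,3$) be finite-dimensional subspaces with $dV_h^k\subset V_h^{k+1}$, and let $\pi_h^k:V^k\to V^k_h$ be linear projections onto $V_h^k$ with $d\pi_h=\pi_h d$ and $\|\pi_h^kv\|\le M\|v\|$ for all $v\in V^k$. Put $\mathfrak H_h^k=\{v\in V_h^k: dv=0,\ v\perp dV_h^{k-1}\}$ for $k=2,3$, $E(\sigma)=\inf_{\tau\in V_h^k}\|\sigma-\tau\|$ for $\sigma \in V^k$, and $$\mu=\max_{k\in\{2,3\}}\ \sup_{r\in\mathfrak H^k,\ \|r\|=1}\|(I-\pi_h^k)r\|$$ (a supremum over the empty set being $0$). For $\nu>0$ let $$\begin{aligned}B_0(&(u_1,u_2,u_3,\phi_2,\phi_3),(v_1,v_2,v_3,\chi_2,\chi_3))=\langle u_1,v_1\rangle-\langle u_2,dv_1\rangle+\nu\langle du_1,v_2\rangle-\langle u_3,dv_2\rangle\\&+\langle\phi_2,v_2\rangle+\langle du_2,v_3\rangle+\langle\phi_3,v_3\rangle+\langle u_2,\chi_2\rangle+\langle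 u_3,\chi_3\rangle.\end{aligned}$$ **Theorem.** Let $(f_2,f_3)\in W^2\times W^3$. Let $(u_1,u_2,u_3,\phi_2,\phi_3)\in V^1\times V^2\times V^3\times\mathfrak H^2\times\mathfrak H^3$ be the solution of $$B_0((u_1,u_2,u_3,\phi_2,\phi_3),(v_1,v_2,v_3,\chi_2,\chi_3))=\langle f_2,v_2\rangle+\langle f_3,v_3\rangle$$ for all $(v_1,v_2,v_3,\chi_2,\chi_3)\in V^1\times V^2\times V^3\times\mathfrak H^2\times\mathfrak H^3$, and let $(u_{1h},u_{2h},u_{3h},\phi_{2h},\phi_{3h})\in V_h^1\times V_h^2\times V_h^3\times\mathfrak H_h^2\times\mathfrak H_h^3$ be the solution of the same equation for all test functions in $V_h^1\times V_h^2\times V_h^3\times\mathfrak H_h^2\times\mathfrak H_h^3$. Then $$\begin{aligned}&\|u_1-u_{1h}\|_V+\|u_2-u_{2h}\|_V+\|u_3-u_{3h}\|+\|\phi_2-\phi_{2h}\|+\|\phi_3-\phi_{3h}\|\\&\le K\Big(\inf_{v_1\in V_h^1}\|u_1-v_1\|_V+\inf_{v_2\in V_h^2}\|u_2-v_2\|_V+E(u_3)+E(\phi_2)+E(\phi_3)+\mu\big(E(P_{\mathfrak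 B}u_2)+E(P_{\mathfrak B}u_3)\big)\Big),\end{aligned}$$ where $K>0$ depends only on $\nu$ and on upper bounds $\kappa \ge c_p$ and $M$ for the Poincaré constant and the $W$-norms of the projections; in particular $K$ does not depend on $h$ or on the data. -/

import Mathlib

open MeasureTheory
open scoped ContDiff

noncomputable section

/-! ### Hilbert complexes -/

/-- A Hilbert complex `W₀ → W₁ → W₂ → W₃`: closed densely defined unbounded operators `d⁰, d¹, d²`
with `d ∘ d = 0`. The domain of `dᵏ` is the space `Vᵏ`; in the top degree `V³ = W₃` and `d³ = 0`. -/
structure HilbertComplex (W₀ W₁ W₂ W₃ : Type*)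
    [NormedAddCommGroup W₀] [InnerProductSpace ℝ W₀]
    [NormedAddCommGroup W₁] [InnerProductSpace ℝ W₁]
    [NormedAddCommGroup W₂] [InnerProductSpace ℝ W₂]
    [NormedAddCommGroup W₃] [InnerProductSpace ℝ W₃] where
  d0 : W₀ →ₗ.[ℝ] W₁
  d1 : W₁ →ₗ.[ℝ] W₂
  d2 : W₂ →ₗ.[ℝ] W₃
  dense_d0 : Dense (d0.domain : Set W₀)
  dense_d1 : Dense (d1.domain : Set W₁)
  dense_d2 : Dense (d2.domain : Set W₂)
  closed_d0 : d0.IsClosed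
  closed_d1 : d1.IsClosed
  closed_d2 : d2.IsClosed
  d0_mem : ∀ u : d0.domain, d0 u ∈ d1.domain
  d1_mem : ∀ u : d1.domain, d1 u ∈ d2.domain
  d1_d0 : ∀ u : d0.domain, d1 ⟨d0 u, d0_mem u⟩ = 0
  d2_d1 : ∀ u : d1.domain, d2 ⟨d1 u, d1_mem u⟩ = 0

/-- The `V`-norm `‖x‖ + ‖T x‖` on the domain of `T`. -/
def vNorm {E F : Type*} [NormedAddCommGroup E] [InnerProductSpace ℝ E]
    [NormedAddCommGroup F] [InnerProductSpace ℝ F] (T : E →ₗ.[ℝ] F) (x : T.domain) : ℝ :=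
  ‖(x : E)‖ + ‖T x‖

/-- Compactness of the inclusion `V ∩ V* ⊂ W`, where `V` is the domain of `T` and `V*` the domain of
the adjoint of `S`: the unit ball for the norm `‖w‖ + ‖T w‖ + ‖S† w‖` is relatively compact. -/
def CompactInclusion {E F G : Type*} [NormedAddCommGroup E] [InnerProductSpace ℝ E]
    [NormedAddCommGroup F] [InnerProductSpace ℝ F] [CompleteSpace E]
    [NormedAddCommGroup G] [InnerProductSpace ℝ G]
    (S : E →ₗ.[ℝ] F) (T : F →ₗ.[ℝ] G) : Prop :=
  IsCompact (closure {w : F | ∃ (h : w ∈ T.domain) (h' : w ∈ S.adjoint.domain),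
    ‖w‖ + ‖T ⟨w, h⟩‖ + ‖S.adjoint ⟨w, h'⟩‖ ≤ 1})

/-- The inequality `‖z‖_V ≤ c ‖T z‖` for all `z` in the domain of `T` orthogonal to the kernel. -/
def PoincareIneq {E F : Type*} [NormedAddCommGroup E] [InnerProductSpace ℝ E]
    [NormedAddCommGroup F] [InnerProductSpace ℝ F] (T : E →ₗ.[ℝ] F) (c : ℝ) : Prop :=
  ∀ z : T.domain, (∀ w : T.domain, T w = 0 → inner ℝ (w : E) (z : E) = 0) →
    vNorm T z ≤ c * ‖T z‖

namespace HilbertComplex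

variable {W₀ W₁ W₂ W₃ : Type*}
  [NormedAddCommGroup W₀] [InnerProductSpace ℝ W₀] [CompleteSpace W₀]
  [NormedAddCommGroup W₁] [InnerProductSpace ℝ W₁] [CompleteSpace W₁]
  [NormedAddCommGroup W₂] [InnerProductSpace ℝ W₂] [CompleteSpace W₂]
  [NormedAddCommGroup W₃] [InnerProductSpace ℝ W₃] [CompleteSpace W₃]

/-- `d¹` as a map `V¹ → V²`. -/
def d1V (C : HilbertComplex W₀ W₁ W₂ W₃) : C.d1.domain →ₗ[ℝ] C.d2.domain :=
  C.d1.toFun.codRestrict C.d2.domain C.d1_mem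

/-- The compactness property in degrees `1, 2, 3`. In degree `3`, `d³ = 0` on all of `W₃`. -/
def CompactnessProperty (C : HilbertComplex W₀ W₁ W₂ W₃) : Prop :=
  CompactInclusion C.d0 C.d1 ∧ CompactInclusion C.d1 C.d2 ∧
    CompactInclusion C.d2 ((0 : W₃ →ₗ[ℝ] W₃).toPMap ⊤)

/-- The best constant valid in the Poincaré inequalities of `d¹` and `d²` (in degree `3` the
inequality is void since `d³ = 0`). -/
def poincareConst (C : HilbertComplex W₀ W₁ W₂ W₃) : ℝ :=
  sInf {c : ℝ | 0 ≤ c ∧ PoincareIneq C.d1 c ∧ PoincareIneq C.d2 c}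

/-- `𝔅² = d V¹`. -/
def B2 (C : HilbertComplex W₀ W₁ W₂ W₃) : Submodule ℝ W₂ := LinearMap.range C.d1.toFun

/-- `𝔅³ = d V²`. -/
def B3 (C : HilbertComplex W₀ W₁ W₂ W₃) : Submodule ℝ W₃ := LinearMap.range C.d2.toFun

/-- `ℌ² = ℨ² ∩ (𝔅²)ᗮ`. -/
def H2 (C : HilbertComplex W₀ W₁ W₂ W₃) : Submodule ℝ W₂ :=
  (LinearMap.ker C.d2.toFun).map C.d2.domain.subtype ⊓ C.B2ᗮ

/-- `ℌ³ = ℨ³ ∩ (𝔅³)ᗮ`, where `ℨ³ = W₃`. -/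
def H3 (C : HilbertComplex W₀ W₁ W₂ W₃) : Submodule ℝ W₃ := C.B3ᗮ

/-- The orthogonal projection `P_𝔅` in degree `2`. The closure makes the projection available for
every complex; it changes nothing when `𝔅²` is closed, as the compactness property ensures. -/
def PB2 (C : HilbertComplex W₀ W₁ W₂ W₃) (u : W₂) : W₂ :=
  C.B2.topologicalClosure.starProjection u

/-- The orthogonal projection `P_𝔅` in degree `3`. -/
def PB3 (C : HilbertComplex W₀ W₁ W₂ W₃) (u : W₃) : W₃ :=
  C.B3.topologicalClosure.starProjection u

/-- Tuples `(u₁, u₂, u₃, φ₂, φ₃) ∈ V¹ × V² × V³ × W₂ × W₃`. -/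
structure MixedTuple (C : HilbertComplex W₀ W₁ W₂ W₃) where
  u1 : C.d1.domain
  u2 : C.d2.domain
  u3 : W₃
  φ2 : W₂
  φ3 : W₃

/-- The bilinear form `B₀` with viscosity `ν`. -/
def B₀ (C : HilbertComplex W₀ W₁ W₂ W₃) (ν : ℝ) (u v : C.MixedTuple) : ℝ :=
  inner ℝ (u.u1 : W₁) (v.u1 : W₁) - inner ℝ (u.u2 : W₂) (C.d1 v.u1)
    + ν * inner ℝ (C.d1 u.u1) (v.u2 : W₂) - inner ℝ u.u3 (C.d2 v.u2) + inner ℝ u.φ2 (v.u2 : W₂)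
    + inner ℝ (C.d2 u.u2) v.u3 + inner ℝ u.φ3 v.u3
    + inner ℝ (u.u2 : W₂) v.φ2 + inner ℝ u.u3 v.φ3

/-- `u` solves the continuous mixed problem with data `(f₂, f₃)`. -/
def IsSolution (C : HilbertComplex W₀ W₁ W₂ W₃) (ν : ℝ) (f₂ : W₂) (f₃ : W₃)
    (u : C.MixedTuple) : Prop :=
  u.φ2 ∈ C.H2 ∧ u.φ3 ∈ C.H3 ∧
    ∀ v : C.MixedTuple, v.φ2 ∈ C.H2 → v.φ3 ∈ C.H3 →
      C.B₀ ν u v = inner ℝ f₂ (v.u2 : W₂) + inner ℝ f₃ v.u3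

/-- A discrete (finite dimensional) subcomplex `V¹_h → V²_h → V³_h`, together with a cochain
projection `π_h` from `V` onto it. -/
structure Discretization (C : HilbertComplex W₀ W₁ W₂ W₃) where
  V1 : Submodule ℝ C.d1.domain
  V2 : Submodule ℝ C.d2.domain
  V3 : Submodule ℝ W₃
  finite_V1 : FiniteDimensional ℝ V1
  finite_V2 : FiniteDimensional ℝ V2
  finite_V3 : FiniteDimensional ℝ V3
  d1_mem : ∀ v ∈ V1, C.d1V v ∈ V2
  d2_mem : ∀ v ∈ V2, C.d2 v ∈ V3
  π1 : C.d1.domain →ₗ[ℝ] C.d1.domain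
  π2 : C.d2.domain →ₗ[ℝ] C.d2.domain
  π3 : W₃ →ₗ[ℝ] W₃
  π1_mem : ∀ v, π1 v ∈ V1
  π2_mem : ∀ v, π2 v ∈ V2
  π3_mem : ∀ v, π3 v ∈ V3
  π1_eq : ∀ v ∈ V1, π1 v = v
  π2_eq : ∀ v ∈ V2, π2 v = v
  π3_eq : ∀ v ∈ V3, π3 v = v
  d1_π1 : ∀ v, C.d1V (π1 v) = π2 (C.d1V v)
  d2_π2 : ∀ v, C.d2 (π2 v) = π3 (C.d2 v)

namespace Discretization

variable {C : HilbertComplex W₀ W₁ W₂ W₃}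

/-- The cochain projection is bounded by `M` for the `W`-norm, in every degree. -/
def ProjBound (D : C.Discretization) (M : ℝ) : Prop :=
  (∀ v : C.d1.domain, ‖(D.π1 v : W₁)‖ ≤ M * ‖(v : W₁)‖) ∧
  (∀ v : C.d2.domain, ‖(D.π2 v : W₂)‖ ≤ M * ‖(v : W₂)‖) ∧
  (∀ v : W₃, ‖D.π3 v‖ ≤ M * ‖v‖)

/-- The discrete harmonic forms `ℌ²_h = ℨ²_h ∩ (d V¹_h)ᗮ`. -/
def H2h (D : C.Discretization) : Submodule ℝ W₂ :=
  (D.V2 ⊓ LinearMap.ker C.d2.toFun).map C.d2.domain.subtype ⊓ (D.V1.map C.d1.toFun)ᗮ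

/-- The discrete harmonic forms `ℌ³_h = V³_h ∩ (d V²_h)ᗮ`. -/
def H3h (D : C.Discretization) : Submodule ℝ W₃ :=
  D.V3 ⊓ (D.V2.map C.d2.toFun)ᗮ

/-- `u` solves the discrete mixed problem with data `(f₂, f₃)`. -/
def IsSolution (D : C.Discretization) (ν : ℝ) (f₂ : W₂) (f₃ : W₃) (u : C.MixedTuple) : Prop :=
  u.u1 ∈ D.V1 ∧ u.u2 ∈ D.V2 ∧ u.u3 ∈ D.V3 ∧ u.φ2 ∈ D.H2h ∧ u.φ3 ∈ D.H3h ∧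
    ∀ v : C.MixedTuple, v.u1 ∈ D.V1 → v.u2 ∈ D.V2 → v.u3 ∈ D.V3 → v.φ2 ∈ D.H2h →
      v.φ3 ∈ D.H3h → C.B₀ ν u v = inner ℝ f₂ (v.u2 : W₂) + inner ℝ f₃ v.u3

/-- `E(σ) = inf_{τ ∈ V²_h} ‖σ - τ‖`. -/
def E2 (D : C.Discretization) (σ : W₂) : ℝ := ⨅ τ : D.V2, ‖σ - ((τ : C.d2.domain) : W₂)‖

/-- `E(σ) = inf_{τ ∈ V³_h} ‖σ - τ‖`. -/
def E3 (D : C.Discretization) (σ : W₃) : ℝ := ⨅ τ : D.V3, ‖σ - (τ : W₃)‖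

/-- `inf_{v ∈ V¹_h} ‖u - v‖_V`. -/
def bestV1 (D : C.Discretization) (u : C.d1.domain) : ℝ :=
  ⨅ v : D.V1, vNorm C.d1 (u - (v : C.d1.domain))

/-- `inf_{v ∈ V²_h} ‖u - v‖_V`. -/
def bestV2 (D : C.Discretization) (u : C.d2.domain) : ℝ :=
  ⨅ v : D.V2, vNorm C.d2 (u - (v : C.d2.domain))

/-- `μ = max_{k ∈ {2,3}} sup {‖(I - π_h) r‖ : r ∈ ℌᵏ, ‖r‖ = 1}`; the supremum over the empty set
(that is, when `ℌᵏ = 0`) is `0`. -/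
def mu (D : C.Discretization) : ℝ :=
  max (⨆ r : {r : C.d2.domain // (r : W₂) ∈ C.H2 ∧ ‖(r : W₂)‖ = 1},
        ‖((r : C.d2.domain) : W₂) - (D.π2 r : W₂)‖)
      (⨆ r : {r : W₃ // r ∈ C.H3 ∧ ‖r‖ = 1}, ‖(r : W₃) - D.π3 r‖)

end Discretization

end HilbertComplex

/-! ### The `L²` de Rham complex of a domain of `ℝ³`, in vector proxies -/

/-- Three-dimensional Euclidean space. -/
abbrev R3 : Type := EuclideanSpace ℝ (Fin 3)

/-- Scalar `L²` fields on `Ω`. -/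
abbrev L2s (Ω : Set R3) : Type := Lp ℝ 2 (volume.restrict Ω)

/-- Vector `L²` fields on `Ω`. -/
abbrev L2v (Ω : Set R3) : Type := Lp R3 2 (volume.restrict Ω)

/-- `ψ ∈ C_c^∞(Ω; F)`. -/
def IsTestField {F : Type*} [NormedAddCommGroup F] [NormedSpace ℝ F]
    (Ω : Set R3) (ψ : R3 → F) : Prop :=
  ContDiff ℝ ∞ ψ ∧ HasCompactSupport ψ ∧ tsupport ψ ⊆ Ω

/-- The partial derivative `∂_i ψ_j`. -/
def pderiv3 (ψ : R3 → R3) (i j : Fin 3) (x : R3) : ℝ :=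
  (fderiv ℝ ψ x (EuclideanSpace.single i 1)) j

/-- The classical curl. -/
def curl3 (ψ : R3 → R3) (x : R3) : R3 :=
  !₂[pderiv3 ψ 1 2 x - pderiv3 ψ 2 1 x,
     pderiv3 ψ 2 0 x - pderiv3 ψ 0 2 x,
     pderiv3 ψ 0 1 x - pderiv3 ψ 1 0 x]

/-- The classical divergence. -/
def div3 (ψ : R3 → R3) (x : R3) : ℝ := ∑ i : Fin 3, pderiv3 ψ i i x

/-- `g` is the weak gradient of `u` in `Ω`. -/
def HasWeakGrad (Ω : Set R3) (u : L2s Ω) (g : L2v Ω) : Prop :=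
  ∀ ψ : R3 → R3, IsTestField Ω ψ →
    ∫ x in Ω, u x * div3 ψ x = - ∫ x in Ω, inner ℝ (g x) (ψ x)

/-- `w` is the weak curl of `u` in `Ω`. -/
def HasWeakCurl (Ω : Set R3) (u w : L2v Ω) : Prop :=
  ∀ ψ : R3 → R3, IsTestField Ω ψ →
    ∫ x in Ω, inner ℝ (u x) (curl3 ψ x) = ∫ x in Ω, inner ℝ (w x) (ψ x)

/-- `q` is the weak divergence of `u` in `Ω`. -/
def HasWeakDiv (Ω : Set R3) (u : L2v Ω) (q : L2s Ω) : Prop :=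
  ∀ ψ : R3 → ℝ, IsTestField Ω ψ →
    ∫ x in Ω, inner ℝ (u x) (gradient ψ x) = - ∫ x in Ω, q x * ψ x

/-- The complex is an `L²` de Rham complex of `Ω`: its differentials are the weak gradient, curl and
divergence, on domains that contain the test fields. The freedom in the choice of the domains is
the choice of the boundary conditions; for instance `H¹, H(curl), H(div)` (no essential condition)
and `H¹₀, H₀(curl), H₀(div)` (essential conditions on the whole boundary) are possible. -/
structure IsDeRham (Ω : Set R3)
    (C : HilbertComplex (L2s Ω) (L2v Ω) (L2v Ω) (L2s Ω)) : Prop where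
  grad : ∀ u : C.d0.domain, HasWeakGrad Ω u (C.d0 u)
  curl : ∀ u : C.d1.domain, HasWeakCurl Ω u (C.d1 u)
  div : ∀ u : C.d2.domain, HasWeakDiv Ω u (C.d2 u)
  test0 : ∀ (u : L2s Ω) (ψ : R3 → ℝ), IsTestField Ω ψ → u =ᵐ[volume.restrict Ω] ψ →
    u ∈ C.d0.domain
  test1 : ∀ (u : L2v Ω) (ψ : R3 → R3), IsTestField Ω ψ → u =ᵐ[volume.restrict Ω] ψ →
    u ∈ C.d1.domain
  test2 : ∀ (u : L2v Ω) (ψ : R3 → R3), IsTestField Ω ψ → u =ᵐ[volume.restrict Ω] ψ →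
    u ∈ C.d2.domain

end

/-!
Subtracting the discrete equations from the continuous ones and testing with one variable at a time
gives `d(u₁ - u₁ₕ) ⊥ d V¹ₕ` and `d(u₂ - u₂ₕ) ⊥ d V²ₕ`. The bounded cochain projections
carry the Poincaré inequality over to the discrete spaces with constant `M κ`, so each component
is quasi-optimal up to errors already estimated, in the order `u₁, u₂, φ₂, φ₃, u₃`.

The one defect of conformity is that `u₂` and `u₂ₕ` are orthogonal to different spaces `ℌ²` and
`ℌ²ₕ`. Write a discrete harmonic form as `r = db + s` with `s ∈ ℌ²`. Then `⟨u₂, r⟩ = ⟨P_𝔅 u₂, r⟩`,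
and as `r` is orthogonal to `d V¹ₕ` this equals `⟨(I - πₕ) P_𝔅 u₂, db⟩`. Since `πₕ r = r`, the
difference `db - dπₕb` equals `-(I - πₕ)s`, and `db ⊥ dπₕb`, so `‖db‖ ≤ μ ‖r‖`: this is the product
`μ E(P_𝔅 u₂)`. There is no such term in degree `3`, where `u₃ ∈ 𝔅³` and `u₃ₕ ∈ d V²ₕ`.
-/

section Approximation

open scoped InnerProductSpace

theorem le_mul_iInf_add {ι : Type*} [Nonempty ι] {a c δ : ℝ} {f : ι → ℝ} (hc : 0 ≤ c)
    (h : ∀ i, a ≤ c * f i + δ) : a ≤ c * (⨅ i, f i) + δ := by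
  rw [Real.mul_iInf_of_nonneg hc, ← sub_le_iff_le_add]
  exact le_ciInf fun i => sub_le_iff_le_add.2 (h i)

theorem norm_sub_map_le {F X : Type*} [SeminormedAddCommGroup X] [FunLike F X X]
    [AddMonoidHomClass F X X] {p : F} {N : ℝ} (hp : ∀ x, ‖p x‖ ≤ N * ‖x‖) {v : X} (hv : p v = v)
    (x : X) : ‖x - p x‖ ≤ (1 + N) * ‖x - v‖ :=
  calc ‖x - p x‖ = ‖(x - v) - p (x - v)‖ := by rw [map_sub, hv, sub_sub_sub_cancel_right]
    _ ≤ ‖x - v‖ + N * ‖x - v‖ := (norm_sub_le _ _).trans (by gcongr; exact hp _)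
    _ = (1 + N) * ‖x - v‖ := by ring

variable {𝕜 X Y : Type*} [RCLike 𝕜] [NormedAddCommGroup X]

theorem norm_map_le_iSup_mul_norm [NormedSpace 𝕜 X] [SeminormedAddCommGroup Y] [NormedSpace 𝕜 Y]
    {f : X →ₗ[𝕜] Y} {S : Submodule 𝕜 X} {C : ℝ} (hf : ∀ x ∈ S, ‖f x‖ ≤ C * ‖x‖) {x : X}
    (hx : x ∈ S) : ‖f x‖ ≤ (⨆ r : {r : X // r ∈ S ∧ ‖r‖ = 1}, ‖f r‖) * ‖x‖ := by
  rcases eq_or_ne x 0 with rfl | hx0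
  · rw [map_zero, norm_zero, norm_zero, mul_zero]
  have hbdd : BddAbove (Set.range fun r : {r : X // r ∈ S ∧ ‖r‖ = 1} => ‖f r‖) := by
    refine ⟨C, ?_⟩
    rintro _ ⟨r, rfl⟩
    simpa only [r.2.2, mul_one] using hf r r.2.1
  have hle := le_ciSup hbdd ⟨(‖x‖⁻¹ : 𝕜) • x, S.smul_mem _ hx, norm_smul_inv_norm hx0⟩
  rwa [map_smul, norm_smul, norm_inv, RCLike.norm_ofReal, abs_norm,
    inv_mul_le_iff₀' (norm_pos_iff.2 hx0)] at hle

variable [InnerProductSpace 𝕜 X]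

theorem norm_le_norm_add_of_inner_eq_zero {x y : X} (h : ⟪x, y⟫_𝕜 = 0) : ‖x‖ ≤ ‖x + y‖ := by
  have hsq := norm_add_sq_eq_norm_sq_add_norm_sq_of_inner_eq_zero x y h
  refine (mul_self_le_mul_self_iff (norm_nonneg _) (norm_nonneg _)).2 ?_
  exact hsq ▸ le_add_of_nonneg_right (mul_self_nonneg _)

theorem norm_le_of_norm_inner_self_le {x : X} {a : ℝ} (ha : 0 ≤ a) (h : ‖⟪x, x⟫_𝕜‖ ≤ a * ‖x‖) :
    ‖x‖ ≤ a := by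
  rcases (norm_nonneg x).eq_or_lt with hx | hx
  · rwa [← hx]
  · rw [inner_self_eq_norm_sq_to_K, norm_pow, RCLike.norm_ofReal, abs_norm, sq] at h
    exact le_of_mul_le_mul_right h hx

theorem norm_sub_le_of_norm_inner_le {S : Submodule 𝕜 X} {x y s : X} {δ : ℝ} (hδ : 0 ≤ δ)
    (hys : y - s ∈ S) (h : ∀ z ∈ S, ‖⟪x - y, z⟫_𝕜‖ ≤ δ * ‖z‖) : ‖x - y‖ ≤ 2 * ‖x - s‖ + δ := by
  have hinner : ‖⟪y - s, y - s⟫_𝕜‖ ≤ (‖x - s‖ + δ) * ‖y - s‖ :=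
    calc ‖⟪y - s, y - s⟫_𝕜‖ = ‖⟪x - s, y - s⟫_𝕜 - ⟪x - y, y - s⟫_𝕜‖ := by
          rw [← inner_sub_left, sub_sub_sub_cancel_left]
      _ ≤ ‖x - s‖ * ‖y - s‖ + δ * ‖y - s‖ :=
          (norm_sub_le _ _).trans (add_le_add (norm_inner_le_norm _ _) (h _ hys))
      _ = (‖x - s‖ + δ) * ‖y - s‖ := by ring
  have hle : ‖y - s‖ ≤ ‖x - s‖ + δ := norm_le_of_norm_inner_self_le (by positivity) hinner
  linarith [norm_sub_le_norm_sub_add_norm_sub x s y, norm_sub_rev y s]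

theorem norm_inner_le_of_le_of_orthogonal_inf {S Z : Submodule 𝕜 X} [S.HasOrthogonalProjection]
    (hSZ : S ≤ Z) {x : X} {a b : ℝ} (ha : 0 ≤ a) (hb : 0 ≤ b)
    (hS : ∀ s ∈ S, ‖⟪x, s⟫_𝕜‖ ≤ a * ‖s‖) (hR : ∀ r ∈ Sᗮ ⊓ Z, ‖⟪x, r⟫_𝕜‖ ≤ b * ‖r‖)
    {z : X} (hz : z ∈ Z) : ‖⟪x, z⟫_𝕜‖ ≤ (a + b) * ‖z‖ := by
  rw [← Submodule.sup_orthogonal_inf_of_hasOrthogonalProjection hSZ] at hz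
  obtain ⟨s, hs, r, hr, rfl⟩ := Submodule.mem_sup.1 hz
  have hsr : ⟪s, r⟫_𝕜 = 0 := hr.1 s hs
  calc ‖⟪x, s + r⟫_𝕜‖ ≤ ‖⟪x, s⟫_𝕜‖ + ‖⟪x, r⟫_𝕜‖ := inner_add_right (𝕜 := 𝕜) x s r ▸ norm_add_le _ _
    _ ≤ a * ‖s‖ + b * ‖r‖ := add_le_add (hS s hs) (hR r hr)
    _ ≤ a * ‖s + r‖ + b * ‖s + r‖ := by
        gcongr
        · exact norm_le_norm_add_of_inner_eq_zero hsr
        · exact add_comm r s ▸ norm_le_norm_add_of_inner_eq_zero (inner_eq_zero_symm.1 hsr)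
    _ = (a + b) * ‖s + r‖ := by ring

theorem mem_of_forall_orthogonal_inf_inner_eq_zero {S Z : Submodule 𝕜 X}
    [S.HasOrthogonalProjection] (hSZ : S ≤ Z) {x : X} (hx : x ∈ Z)
    (h : ∀ r ∈ Sᗮ ⊓ Z, ⟪x, r⟫_𝕜 = 0) : x ∈ S := by
  rw [← Submodule.sup_orthogonal_inf_of_hasOrthogonalProjection hSZ] at hx
  obtain ⟨s, hs, r, hr, rfl⟩ := Submodule.mem_sup.1 hx
  have hrr : ⟪r, r⟫_𝕜 = 0 := by simpa [inner_add_left, hr.1 s hs] using h r hr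
  rwa [inner_self_eq_zero.1 hrr, add_zero]

end Approximation

section PoincareIneqOn

open scoped InnerProductSpace

variable {𝕜 X Y : Type*} [RCLike 𝕜] [NormedAddCommGroup X] [InnerProductSpace 𝕜 X]

theorem exists_mem_orthogonal_inf_ker_map_eq [AddCommGroup Y] [Module 𝕜 Y] (f : X →ₗ[𝕜] Y)
    (V : Submodule 𝕜 X) [(V ⊓ LinearMap.ker f).HasOrthogonalProjection] {x : X} (hx : x ∈ V) :
    ∃ y ∈ V, y ∈ (V ⊓ LinearMap.ker f)ᗮ ∧ f y = f x := by
  have hproj := (V ⊓ LinearMap.ker f).starProjection_apply_mem x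
  refine ⟨x - (V ⊓ LinearMap.ker f).starProjection x, V.sub_mem hx hproj.1,
    Submodule.sub_starProjection_mem_orthogonal x, ?_⟩
  rw [map_sub, LinearMap.mem_ker.1 hproj.2, sub_zero]

variable [NormedAddCommGroup Y]

/-- The Poincaré inequality `‖z‖ ≤ c ‖f z‖` for the restriction of `f` to the subspace `V`: it is
required of the `z ∈ V` orthogonal to the kernel of that restriction. With `V = ⊤` this is the
inequality for `f` itself, with `V` a discrete space the discrete one. -/
def PoincareIneqOn [Module 𝕜 Y] (f : X →ₗ[𝕜] Y) (V : Submodule 𝕜 X) (c : ℝ) : Prop :=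
  ∀ z ∈ V, z ∈ (V ⊓ LinearMap.ker f)ᗮ → ‖z‖ ≤ c * ‖f z‖

namespace PoincareIneqOn

theorem exists_map_eq_norm_le [Module 𝕜 Y] {f : X →ₗ[𝕜] Y} {V : Submodule 𝕜 X}
    [(V ⊓ LinearMap.ker f).HasOrthogonalProjection] {c : ℝ} (hP : PoincareIneqOn f V c) {x : X}
    (hx : x ∈ V) : ∃ y ∈ V, f y = f x ∧ ‖y‖ ≤ c * ‖f x‖ := by
  obtain ⟨y, hyV, hy_orth, hfy⟩ := exists_mem_orthogonal_inf_ker_map_eq f V hx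
  exact ⟨y, hyV, hfy, hfy ▸ hP y hyV hy_orth⟩

theorem of_bounded_map [Module 𝕜 Y] {f : X →ₗ[𝕜] Y} [(LinearMap.ker f).HasOrthogonalProjection]
    {c N : ℝ} (hP : PoincareIneqOn f ⊤ c) (hN : 0 ≤ N) {V : Submodule 𝕜 X} {p : X → X}
    (hpV : ∀ x, p x ∈ V) (hpf : ∀ x, ∀ v ∈ V, f x = f v → f (p x) = f v)
    (hp : ∀ x, ‖p x‖ ≤ N * ‖x‖) : PoincareIneqOn f V (N * c) := by
  intro z hz hz_orth
  have : (⊤ ⊓ LinearMap.ker f).HasOrthogonalProjection := by rwa [top_inf_eq]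
  obtain ⟨y, -, hfy, hy⟩ := hP.exists_map_eq_norm_le (Submodule.mem_top (x := z))
  have hker : p y - z ∈ V ⊓ LinearMap.ker f :=
    ⟨V.sub_mem (hpV y) hz, LinearMap.mem_ker.2 (by rw [map_sub, hpf y z hz hfy, sub_self])⟩
  calc ‖z‖ ≤ ‖z + (p y - z)‖ :=
        norm_le_norm_add_of_inner_eq_zero (inner_eq_zero_symm.1 (hz_orth _ hker))
    _ = ‖p y‖ := by rw [add_sub_cancel]
    _ ≤ N * ‖y‖ := hp y
    _ ≤ N * (c * ‖f z‖) := by gcongr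
    _ = N * c * ‖f z‖ := (mul_assoc _ _ _).symm

theorem norm_sub_add_norm_map_sub_le [InnerProductSpace 𝕜 Y] {f : X →ₗ[𝕜] Y} {V : Submodule 𝕜 X}
    [(V ⊓ LinearMap.ker f).HasOrthogonalProjection] {c δ : ℝ} (hP : PoincareIneqOn f V c)
    (hc : 0 ≤ c) (hδ : 0 ≤ δ) {x y s : X} (hy : y ∈ V) (hs : s ∈ V)
    (hmap : ∀ z ∈ V, ⟪f (x - y), f z⟫_𝕜 = 0)
    (hker : ∀ z ∈ V ⊓ LinearMap.ker f, ‖⟪x - y, z⟫_𝕜‖ ≤ δ * ‖z‖) :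
    ‖x - y‖ + ‖f (x - y)‖ ≤ (2 + 2 * c) * (‖x - s‖ + ‖f (x - s)‖) + δ := by
  have hys : y - s ∈ V := V.sub_mem hy hs
  have hsplit : f (x - s) = f (x - y) + f (y - s) := by rw [← map_add, sub_add_sub_cancel]
  have hmap_error : ‖f (x - y)‖ ≤ ‖f (x - s)‖ :=
    hsplit ▸ norm_le_norm_add_of_inner_eq_zero (hmap _ hys)
  have hmap_diff : ‖f (y - s)‖ ≤ ‖f (x - s)‖ := by
    rw [hsplit, add_comm]
    exact norm_le_norm_add_of_inner_eq_zero (inner_eq_zero_symm.1 (hmap _ hys))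
  obtain ⟨w, hwV, hfw, hw⟩ := hP.exists_map_eq_norm_le hys
  have hyw : y - (s + w) ∈ V ⊓ LinearMap.ker f := by
    rw [← sub_sub]
    exact ⟨V.sub_mem hys hwV, LinearMap.mem_ker.2 (by rw [map_sub, hfw, sub_self])⟩
  have herror : ‖x - y‖ ≤ 2 * ‖x - (s + w)‖ + δ := norm_sub_le_of_norm_inner_le hδ hyw hker
  have htri : ‖x - (s + w)‖ ≤ ‖x - s‖ + ‖w‖ := sub_sub x s w ▸ norm_sub_le _ _
  have hw_le : ‖w‖ ≤ c * ‖f (x - s)‖ := hw.trans (by gcongr)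
  linarith [mul_nonneg hc (norm_nonneg (x - s)), norm_nonneg (f (x - s))]

end PoincareIneqOn

end PoincareIneqOn

section ClosedOperators

open Filter Topology

theorem exists_mem_domain_apply_eq_of_tendsto {R E F ι : Type*} [CommRing R] [AddCommGroup E]
    [AddCommGroup F] [Module R E] [Module R F] [TopologicalSpace E] [TopologicalSpace F]
    {T : E →ₗ.[R] F} (hT : T.IsClosed) {l : Filter ι} [l.NeBot] {z : ι → T.domain} {x : E} {y : F}
    (hx : Tendsto (fun i => (z i : E)) l (𝓝 x)) (hy : Tendsto (fun i => T (z i)) l (𝓝 y)) :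
    ∃ h : x ∈ T.domain, T ⟨x, h⟩ = y := by
  have hmem : (x, y) ∈ T.graph :=
    IsClosed.mem_of_tendsto (b := l) hT (hx.prodMk_nhds hy) (.of_forall fun i => T.mem_graph (z i))
  obtain ⟨w, rfl, hw⟩ := T.mem_graph_iff.1 hmem
  exact ⟨w.2, hw⟩

section InnerProductSpace

variable {𝕜 E F : Type*} [RCLike 𝕜] [NormedAddCommGroup E] [InnerProductSpace 𝕜 E]
  [CompleteSpace E] [NormedAddCommGroup F]

theorem completeSpace_ker_of_isClosed [NormedSpace 𝕜 F] {T : E →ₗ.[𝕜] F} (hT : T.IsClosed) :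
    CompleteSpace (LinearMap.ker T.toFun) := by
  have himage : ((↑) '' (LinearMap.ker T.toFun : Set T.domain) : Set E) =
      (fun x => (x, (0 : F))) ⁻¹' T.graph := by
    ext x
    simp [LinearPMap.mem_graph_iff]
  refine completeSpace_coe_iff_isComplete.2 (Subtype.isComplete_iff.2 ?_)
  rw [himage]
  exact (IsClosed.preimage (by fun_prop) hT).isComplete

theorem exists_adjoint_apply_eq_zero [InnerProductSpace 𝕜 F] {S : E →ₗ.[𝕜] F}
    (hS : Dense (S.domain : Set E)) {z : F} (hz : z ∈ (LinearMap.range S.toFun)ᗮ) :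
    ∃ h : z ∈ S.adjoint.domain, S.adjoint ⟨z, h⟩ = 0 := by
  have hzero (x : S.domain) : inner 𝕜 (0 : E) (x : E) = inner 𝕜 z (S x) :=
    (inner_zero_left _).trans (inner_eq_zero_symm.1 (hz _ ⟨x, rfl⟩)).symm
  have hmem := S.mem_adjoint_domain_of_exists z ⟨0, hzero⟩
  exact ⟨hmem, LinearPMap.adjoint_apply_eq hS ⟨z, hmem⟩ hzero⟩

end InnerProductSpace

variable {E F : Type*} [NormedAddCommGroup E] [InnerProductSpace ℝ E]
  [NormedAddCommGroup F] [InnerProductSpace ℝ F]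

theorem vNorm_smul (T : E →ₗ.[ℝ] F) (a : ℝ) (z : T.domain) :
    vNorm T (a • z) = |a| * vNorm T z := by
  rw [vNorm, vNorm, Submodule.coe_smul, LinearPMap.map_smul, norm_smul, norm_smul, Real.norm_eq_abs,
    mul_add]

namespace PoincareIneq

variable {T : E →ₗ.[ℝ] F} {c : ℝ}

theorem mono (hP : PoincareIneq T c) {c' : ℝ} (h : c ≤ c') : PoincareIneq T c' :=
  fun z hz => (hP z hz).trans (by gcongr)

theorem poincareIneqOn_top (hP : PoincareIneq T c) : PoincareIneqOn T.toFun ⊤ c := by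
  intro z _ hz
  rw [top_inf_eq] at hz
  exact (le_add_of_nonneg_right (norm_nonneg _)).trans (hP z hz)

theorem isClosed_range [CompleteSpace E] [CompleteSpace F] (hP : PoincareIneq T c)
    (hT : T.IsClosed) : IsClosed (LinearMap.range T.toFun : Set F) := by
  let N : Submodule ℝ E := (LinearMap.ker T.toFun).map T.domain.subtype
  have hN (z : T.domain) : (z : E) ∈ Nᗮ ↔ z ∈ (LinearMap.ker T.toFun)ᗮ := by
    simp [N, Submodule.mem_orthogonal]
  let G : Submodule ℝ (E × F) := T.graph ⊓ Nᗮ.comap (LinearMap.fst ℝ E F)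
  have : CompleteSpace G :=
    (hT.inter (N.isClosed_orthogonal.preimage continuous_fst)).completeSpace_coe
  let A : G →L[ℝ] F := (ContinuousLinearMap.snd ℝ E F).comp G.subtypeL
  have hbound (g : G) : ‖g‖ ≤ c.toNNReal * ‖A g‖ := by
    obtain ⟨⟨x, y⟩, hg, hx⟩ := g
    obtain ⟨z, rfl, rfl⟩ := T.mem_graph_iff.1 hg
    calc max ‖(z : E)‖ ‖T z‖ ≤ vNorm T z := max_le_add_of_nonneg (norm_nonneg _) (norm_nonneg _)
      _ ≤ c * ‖T z‖ := hP z ((hN z).1 hx)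
      _ ≤ c.toNNReal * ‖T z‖ := by gcongr; exact c.le_coe_toNNReal
  have hrange : (LinearMap.range T.toFun : Set F) = Set.range A := by
    have := completeSpace_ker_of_isClosed hT
    have : (⊤ ⊓ LinearMap.ker T.toFun).HasOrthogonalProjection := by
      rw [top_inf_eq]; infer_instance
    ext y
    constructor
    · rintro ⟨x, rfl⟩
      obtain ⟨z, -, hz, hzx⟩ :=
        exists_mem_orthogonal_inf_ker_map_eq T.toFun ⊤ (Submodule.mem_top (x := x))
      rw [top_inf_eq] at hz
      exact ⟨⟨(z, T z), T.mem_graph z, (hN z).2 hz⟩, hzx⟩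
    · rintro ⟨⟨⟨x, y⟩, hg, -⟩, rfl⟩
      obtain ⟨z, -, rfl⟩ := T.mem_graph_iff.1 hg
      exact ⟨z, rfl⟩
  rw [hrange]
  exact (A.antilipschitz_of_bound hbound).isClosed_range A.uniformContinuous

end PoincareIneq

theorem isClosed_setOf_poincareIneq (T : E →ₗ.[ℝ] F) : IsClosed {c | PoincareIneq T c} := by
  simp only [PoincareIneq, Set.ofPred_forall]
  exact isClosed_iInter fun z => isClosed_iInter fun _ => isClosed_le (by fun_prop) (by fun_prop)

theorem exists_vNorm_eq_one_of_not_poincareIneq {T : E →ₗ.[ℝ] F} {c : ℝ} (hc : 0 ≤ c)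
    (h : ¬PoincareIneq T c) :
    ∃ z ∈ (LinearMap.ker T.toFun)ᗮ, vNorm T z = 1 ∧ c * ‖T z‖ ≤ 1 := by
  simp only [PoincareIneq, not_forall, not_le] at h
  obtain ⟨z, hz, hlt⟩ := h
  have hpos : 0 < vNorm T z := hlt.trans_le' (by positivity)
  refine ⟨(vNorm T z)⁻¹ • z, Submodule.smul_mem _ _ hz, ?_, ?_⟩
  · rw [vNorm_smul, abs_of_pos (inv_pos.2 hpos), inv_mul_cancel₀ hpos.ne']
  · rw [LinearPMap.map_smul, norm_smul, norm_inv, Real.norm_of_nonneg hpos.le, mul_left_comm,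
      inv_mul_le_one₀ hpos]
    exact hlt.le

namespace CompactInclusion

variable {G : Type*} [NormedAddCommGroup G] [InnerProductSpace ℝ G] [CompleteSpace E]
  {S : E →ₗ.[ℝ] F} {T : F →ₗ.[ℝ] G}

theorem exists_poincareIneq (hc : CompactInclusion S T) (hS : Dense (S.domain : Set E))
    (hT : T.IsClosed)
    (hST : LinearMap.range S.toFun ≤ (LinearMap.ker T.toFun).map T.domain.subtype) :
    ∃ c : ℝ, 0 ≤ c ∧ PoincareIneq T c := by
  -- If no constant worked, normalised counterexamples `zₙ ⊥ ker T` with `T zₙ → 0` would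
  -- subconverge to an element of `ker T ∩ (ker T)ᗮ` of norm one.
  by_contra! hno
  choose z hz_orth hz_one hTz using fun n : ℕ =>
    exists_vNorm_eq_one_of_not_poincareIneq (by positivity) (hno (n + 1) (by positivity))
  have hz_mem (n : ℕ) : (z n : F) ∈ closure {w : F | ∃ (h : w ∈ T.domain)
      (h' : w ∈ S.adjoint.domain), ‖w‖ + ‖T ⟨w, h⟩‖ + ‖S.adjoint ⟨w, h'⟩‖ ≤ 1} := by
    have hz_range : (z n : F) ∈ (LinearMap.range S.toFun)ᗮ := by
      refine Submodule.orthogonal_le hST ?_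
      rintro _ ⟨w, hw, rfl⟩
      exact hz_orth n w hw
    obtain ⟨hadj, hadj_zero⟩ := exists_adjoint_apply_eq_zero hS hz_range
    refine subset_closure ⟨(z n).2, hadj, ?_⟩
    rw [hadj_zero, norm_zero, add_zero]
    exact (hz_one n).le
  obtain ⟨x, -, φ, hφ, hx⟩ := IsCompact.tendsto_subseq hc hz_mem
  have hT_zero : Tendsto (fun n => T (z n)) atTop (𝓝 0) :=
    squeeze_zero_norm (fun n => (le_div_iff₀' (by positivity)).2 (hTz n))
      tendsto_one_div_add_atTop_nhds_zero_nat
  have hT_zero_subseq := hT_zero.comp hφ.tendsto_atTop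
  obtain ⟨hxT, hTx⟩ := exists_mem_domain_apply_eq_of_tendsto hT (z := z ∘ φ) hx hT_zero_subseq
  have hx_zero : x = 0 := by
    refine inner_self_eq_zero (𝕜 := ℝ).1 (tendsto_nhds_unique (tendsto_const_nhds.inner hx) ?_)
    exact tendsto_const_nhds.congr fun n => (hz_orth (φ n) ⟨x, hxT⟩ hTx).symm
  have hlim : Tendsto (fun n => vNorm T (z (φ n))) atTop (𝓝 (‖x‖ + ‖(0 : G)‖)) :=
    hx.norm.add hT_zero_subseq.norm
  simp only [hz_one, hx_zero, norm_zero, add_zero] at hlim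
  exact one_ne_zero (tendsto_nhds_unique tendsto_const_nhds hlim)

end CompactInclusion

end ClosedOperators

section HarmonicForms

open scoped InnerProductSpace

namespace HilbertComplex

variable {W₀ W₁ W₂ W₃ : Type*}
  [NormedAddCommGroup W₀] [InnerProductSpace ℝ W₀]
  [NormedAddCommGroup W₁] [InnerProductSpace ℝ W₁]
  [NormedAddCommGroup W₂] [InnerProductSpace ℝ W₂]
  [NormedAddCommGroup W₃] [InnerProductSpace ℝ W₃]
  {C : HilbertComplex W₀ W₁ W₂ W₃}

theorem CompactnessProperty.poincareIneq [CompleteSpace W₀] [CompleteSpace W₁] [CompleteSpace W₂]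
    (hC : C.CompactnessProperty) {κ : ℝ} (hκ : C.poincareConst ≤ κ) :
    PoincareIneq C.d1 κ ∧ PoincareIneq C.d2 κ := by
  have hd01 : LinearMap.range C.d0.toFun ≤ (LinearMap.ker C.d1.toFun).map C.d1.domain.subtype := by
    rintro _ ⟨v, rfl⟩
    exact ⟨⟨C.d0 v, C.d0_mem v⟩, C.d1_d0 v, rfl⟩
  have hd12 : LinearMap.range C.d1.toFun ≤ (LinearMap.ker C.d2.toFun).map C.d2.domain.subtype := by
    rintro _ ⟨v, rfl⟩
    exact ⟨⟨C.d1 v, C.d1_mem v⟩, C.d2_d1 v, rfl⟩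
  obtain ⟨c₁, hc₁, hP₁⟩ := CompactInclusion.exists_poincareIneq hC.1 C.dense_d0 C.closed_d1 hd01
  obtain ⟨c₂, -, hP₂⟩ := CompactInclusion.exists_poincareIneq hC.2.1 C.dense_d1 C.closed_d2 hd12
  have hclosed : IsClosed {c : ℝ | 0 ≤ c ∧ PoincareIneq C.d1 c ∧ PoincareIneq C.d2 c} :=
    isClosed_Ici.inter
      ((isClosed_setOf_poincareIneq C.d1).inter (isClosed_setOf_poincareIneq C.d2))
  have hbest := hclosed.csInf_mem
    ⟨max c₁ c₂, le_max_of_le_left hc₁, hP₁.mono (le_max_left _ _), hP₂.mono (le_max_right _ _)⟩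
    ⟨0, fun _ hc => hc.1⟩
  exact ⟨hbest.2.1.mono hκ, hbest.2.2.mono hκ⟩

theorem d2_d1V (v : C.d1.domain) : C.d2 (C.d1V v) = 0 :=
  C.d2_d1 v

theorem coe_mem_H2_iff {r : C.d2.domain} :
    (r : W₂) ∈ C.H2 ↔ C.d2 r = 0 ∧ ∀ v, ⟪C.d1V v, r⟫_ℝ = 0 := by
  simp only [H2, B2, Submodule.mem_inf, Submodule.mem_orthogonal, LinearMap.mem_range,
    forall_exists_index, forall_apply_eq_imp_iff, Submodule.mem_map, LinearMap.mem_ker,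
    Submodule.subtype_apply, Subtype.coe_inj, exists_eq_right]
  rfl

theorem exists_coe_eq_of_mem_H2 {x : W₂} (hx : x ∈ C.H2) : ∃ r : C.d2.domain, (r : W₂) = x :=
  hx.1.imp fun _ h => h.2

section Projection

variable [CompleteSpace W₂]

theorem exists_d1_eq_PB2 (hB : IsClosed (C.B2 : Set W₂)) (x : W₂) : ∃ b, C.d1 b = C.PB2 x :=
  hB.submodule_topologicalClosure_eq.le (C.B2.topologicalClosure.starProjection_apply_mem x)

theorem inner_sub_PB2_d1 (x : W₂) (v : C.d1.domain) : ⟪x - C.PB2 x, C.d1 v⟫_ℝ = 0 :=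
  C.B2.topologicalClosure.starProjection_inner_eq_zero x _ (C.B2.le_topologicalClosure ⟨v, rfl⟩)

theorem exists_eq_d1V_add_harmonic (hB : IsClosed (C.B2 : Set W₂)) {r : C.d2.domain}
    (hr : C.d2 r = 0) : ∃ (b : C.d1.domain) (s : C.d2.domain), (s : W₂) ∈ C.H2 ∧
      r = C.d1V b + s := by
  obtain ⟨b, hb⟩ := exists_d1_eq_PB2 hB (r : W₂)
  refine ⟨b, r - C.d1V b, coe_mem_H2_iff.2 ⟨?_, fun v => ?_⟩, (add_sub_cancel _ _).symm⟩
  · rw [LinearPMap.map_sub, hr, d2_d1V, sub_zero]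
  · rw [real_inner_comm]
    change ⟪(r : W₂) - C.d1 b, C.d1 v⟫_ℝ = 0
    rw [hb, inner_sub_PB2_d1]

theorem inner_eq_inner_PB2 (hB : IsClosed (C.B2 : Set W₂)) {u : W₂} (hu : u ∈ C.H2ᗮ)
    {r : C.d2.domain} (hr : C.d2 r = 0) : ⟪u, (r : W₂)⟫_ℝ = ⟪C.PB2 u, (r : W₂)⟫_ℝ := by
  obtain ⟨a, ha⟩ := exists_d1_eq_PB2 hB u
  obtain ⟨b, s, hs, rfl⟩ := exists_eq_d1V_add_harmonic hB hr
  have hPB2_s : ⟪C.PB2 u, (s : W₂)⟫_ℝ = 0 := ha ▸ (coe_mem_H2_iff.1 hs).2 a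
  have hu_s : ⟪u, (s : W₂)⟫_ℝ = 0 := inner_eq_zero_symm.1 (hu _ hs)
  rw [← sub_eq_zero, ← inner_sub_left, Submodule.coe_add, inner_add_right,
    inner_sub_left u _ (s : W₂), hPB2_s, hu_s, sub_zero, add_zero]
  exact inner_sub_PB2_d1 u b

end Projection

namespace Discretization

variable (D : C.Discretization)

attribute [local instance] finite_V1 finite_V2

/-- The discrete cycles `ℨ²_h`, as a subspace of `V²`. -/
abbrev Z2h : Submodule ℝ C.d2.domain := D.V2 ⊓ LinearMap.ker C.d2.toFun

/-- The discrete boundaries `𝔅²_h = d V¹_h`, as a subspace of `V²`. -/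
abbrev B2h : Submodule ℝ C.d2.domain := D.V1.map C.d1V

/-- The discrete boundaries `𝔅³_h = d V²_h`. -/
abbrev B3h : Submodule ℝ W₃ := D.V2.map C.d2.toFun

variable {D}

theorem B2h_le_Z2h : D.B2h ≤ D.Z2h := by
  rintro _ ⟨v, hv, rfl⟩
  exact ⟨D.d1_mem v hv, d2_d1V v⟩

theorem B3h_le_V3 : D.B3h ≤ D.V3 := by
  rintro _ ⟨v, hv, rfl⟩
  exact D.d2_mem v hv

theorem coe_mem_H2h_iff {r : C.d2.domain} : (r : W₂) ∈ D.H2h ↔ r ∈ D.B2hᗮ ⊓ D.Z2h := by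
  simp only [H2h, Submodule.mem_inf, Submodule.mem_orthogonal, Submodule.mem_map,
    forall_exists_index, and_imp, forall_apply_eq_imp_iff₂, LinearMap.mem_ker,
    Submodule.subtype_apply, Subtype.coe_inj, exists_eq_right]
  exact and_comm

theorem exists_coe_eq_of_mem_H2h {x : W₂} (hx : x ∈ D.H2h) : ∃ r : C.d2.domain, (r : W₂) = x :=
  hx.1.imp fun _ h => h.2

theorem E2_nonneg (σ : W₂) : 0 ≤ D.E2 σ := Real.iInf_nonneg fun _ => norm_nonneg _

theorem E3_nonneg (σ : W₃) : 0 ≤ D.E3 σ := Real.iInf_nonneg fun _ => norm_nonneg _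

theorem bestV1_nonneg (u : C.d1.domain) : 0 ≤ D.bestV1 u :=
  Real.iInf_nonneg fun _ => add_nonneg (norm_nonneg _) (norm_nonneg _)

theorem bestV2_nonneg (u : C.d2.domain) : 0 ≤ D.bestV2 u :=
  Real.iInf_nonneg fun _ => add_nonneg (norm_nonneg _) (norm_nonneg _)

theorem mu_nonneg : 0 ≤ D.mu :=
  le_max_of_le_left (Real.iSup_nonneg fun _ => norm_nonneg _)

namespace ProjBound

variable {N : ℝ}

theorem mono (hD : D.ProjBound N) {N' : ℝ} (h : N ≤ N') : D.ProjBound N' :=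
  ⟨fun v => (hD.1 v).trans (by gcongr), fun v => (hD.2.1 v).trans (by gcongr),
    fun v => (hD.2.2 v).trans (by gcongr)⟩

theorem norm_sub_π2_le_E2 (hD : D.ProjBound N) (hN : 0 ≤ N) (v : C.d2.domain) :
    ‖v - D.π2 v‖ ≤ (1 + N) * D.E2 v := by
  rw [E2, Real.mul_iInf_of_nonneg (by positivity)]
  exact le_ciInf fun τ => norm_sub_map_le (p := D.π2) hD.2.1 (D.π2_eq τ τ.2) v

theorem norm_sub_π3_le_E3 (hD : D.ProjBound N) (hN : 0 ≤ N) (v : W₃) :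
    ‖v - D.π3 v‖ ≤ (1 + N) * D.E3 v := by
  rw [E3, Real.mul_iInf_of_nonneg (by positivity)]
  exact le_ciInf fun τ => norm_sub_map_le (p := D.π3) hD.2.2 (D.π3_eq τ τ.2) v

theorem poincareIneqOn_d1 [CompleteSpace W₁] (hD : D.ProjBound N) (hN : 0 ≤ N) {κ : ℝ}
    (hP : PoincareIneq C.d1 κ) : PoincareIneqOn C.d1.toFun D.V1 (N * κ) := by
  have := completeSpace_ker_of_isClosed C.closed_d1
  refine hP.poincareIneqOn_top.of_bounded_map hN D.π1_mem (fun x v hv hxv => ?_) hD.1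
  have hd : C.d1V (D.π1 x) = C.d1V v := by
    rw [D.d1_π1, show C.d1V x = C.d1V v from Subtype.ext hxv, D.π2_eq _ (D.d1_mem v hv)]
  exact congrArg Subtype.val hd

theorem poincareIneqOn_d2 [CompleteSpace W₂] (hD : D.ProjBound N) (hN : 0 ≤ N) {κ : ℝ}
    (hP : PoincareIneq C.d2 κ) : PoincareIneqOn C.d2.toFun D.V2 (N * κ) := by
  have := completeSpace_ker_of_isClosed C.closed_d2
  refine hP.poincareIneqOn_top.of_bounded_map hN D.π2_mem (fun x v hv hxv => ?_) hD.2.1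
  exact (D.d2_π2 x).trans ((congrArg D.π3 hxv).trans (D.π3_eq _ (D.d2_mem v hv)))

theorem norm_sub_π2_le_mu_mul (hD : D.ProjBound N) {r : C.d2.domain} (hr : (r : W₂) ∈ C.H2) :
    ‖r - D.π2 r‖ ≤ D.mu * ‖r‖ := by
  have hbound (x : C.d2.domain) : ‖x - D.π2 x‖ ≤ (1 + N) * ‖x‖ := by
    simpa only [sub_zero] using norm_sub_map_le (p := D.π2) hD.2.1 (map_zero D.π2) x
  refine (norm_map_le_iSup_mul_norm (f := LinearMap.id - D.π2)
    (S := C.H2.comap C.d2.domain.subtype) (fun x _ => hbound x) hr).trans ?_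
  gcongr
  exact le_max_left _ _

theorem norm_d1V_le_mu_mul_norm_add (hD : D.ProjBound N) {b : C.d1.domain} {s : C.d2.domain}
    (hs : (s : W₂) ∈ C.H2) (hbs : C.d1V b + s ∈ D.B2hᗮ ⊓ D.Z2h) :
    ‖C.d1V b‖ ≤ D.mu * ‖C.d1V b + s‖ := by
  have hs_orth (v : C.d1.domain) : ⟪C.d1V v, s⟫_ℝ = 0 := (coe_mem_H2_iff.1 hs).2 v
  have hproj_orth : ⟪C.d1V b, -C.d1V (D.π1 b)⟫_ℝ = 0 := by
    have h := hbs.1 _ ⟨D.π1 b, D.π1_mem b, rfl⟩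
    rwa [inner_add_right, hs_orth, add_zero, real_inner_comm, ← neg_eq_zero, ← inner_neg_right] at h
  have hdefect : C.d1V b + -C.d1V (D.π1 b) = -(s - D.π2 s) := by
    have h := D.π2_eq _ hbs.2.1
    rw [map_add] at h
    rw [D.d1_π1, eq_sub_of_add_eq h]
    abel
  calc ‖C.d1V b‖ ≤ ‖C.d1V b + -C.d1V (D.π1 b)‖ := norm_le_norm_add_of_inner_eq_zero hproj_orth
    _ = ‖s - D.π2 s‖ := by rw [hdefect, norm_neg]
    _ ≤ D.mu * ‖s‖ := hD.norm_sub_π2_le_mu_mul hs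
    _ ≤ D.mu * ‖C.d1V b + s‖ := by
        gcongr
        · exact mu_nonneg
        · rw [add_comm]
          exact norm_le_norm_add_of_inner_eq_zero (inner_eq_zero_symm.1 (hs_orth b))

theorem norm_inner_d1V_le [CompleteSpace W₂] (hD : D.ProjBound N) (hN : 0 ≤ N)
    (hB : IsClosed (C.B2 : Set W₂)) (a : C.d1.domain) {r : C.d2.domain}
    (hr : r ∈ D.B2hᗮ ⊓ D.Z2h) :
    ‖⟪C.d1V a, r⟫_ℝ‖ ≤ (1 + N) * D.E2 (C.d1 a) * D.mu * ‖r‖ := by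
  obtain ⟨b, s, hs, rfl⟩ := exists_eq_d1V_add_harmonic hB hr.2.2
  have hinner : ⟪C.d1V a, C.d1V b + s⟫_ℝ = ⟪C.d1V a - D.π2 (C.d1V a), C.d1V b⟫_ℝ := by
    have hpos := hr.1 _ ⟨D.π1 a, D.π1_mem a, rfl⟩
    rw [inner_add_right, (coe_mem_H2_iff.1 hs).2, add_zero] at hpos ⊢
    rw [inner_sub_left, ← D.d1_π1, hpos, sub_zero]
  calc ‖⟪C.d1V a, C.d1V b + s⟫_ℝ‖ ≤ ‖C.d1V a - D.π2 (C.d1V a)‖ * ‖C.d1V b‖ :=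
        hinner ▸ norm_inner_le_norm _ _
    _ ≤ (1 + N) * D.E2 (C.d1V a) * (D.mu * ‖C.d1V b + s‖) :=
        mul_le_mul (hD.norm_sub_π2_le_E2 hN _) (hD.norm_d1V_le_mu_mul_norm_add hs hr)
          (norm_nonneg _) (mul_nonneg (by positivity) (E2_nonneg _))
    _ = _ := (mul_assoc _ _ _).symm

end ProjBound

end Discretization

end HilbertComplex

end HarmonicForms

section ErrorEstimates

open scoped InnerProductSpace

namespace HilbertComplex

variable {W₀ W₁ W₂ W₃ : Type*}
  [NormedAddCommGroup W₀] [InnerProductSpace ℝ W₀]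
  [NormedAddCommGroup W₁] [InnerProductSpace ℝ W₁]
  [NormedAddCommGroup W₂] [InnerProductSpace ℝ W₂]
  [NormedAddCommGroup W₃] [InnerProductSpace ℝ W₃]
  {C : HilbertComplex W₀ W₁ W₂ W₃} {ν : ℝ} {f₂ : W₂} {f₃ : W₃} {u uh : C.MixedTuple}

namespace IsSolution

theorem u2_mem_orthogonal_H2 (hu : C.IsSolution ν f₂ f₃ u) : (u.u2 : W₂) ∈ C.H2ᗮ := by
  refine (Submodule.mem_orthogonal' _ _).2 fun χ hχ => ?_
  simpa [B₀] using hu.2.2 ⟨0, 0, 0, χ, 0⟩ hχ C.H3.zero_mem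

theorem u3_mem_orthogonal_H3 (hu : C.IsSolution ν f₂ f₃ u) : u.u3 ∈ C.H3ᗮ := by
  refine (Submodule.mem_orthogonal' _ _).2 fun χ hχ => ?_
  simpa [B₀] using hu.2.2 ⟨0, 0, 0, 0, χ⟩ C.H2.zero_mem hχ

theorem exists_d2_eq_u3 [CompleteSpace W₃] (hu : C.IsSolution ν f₂ f₃ u)
    (hB : IsClosed (C.B3 : Set W₃)) : ∃ w, C.d2 w = u.u3 := by
  have : CompleteSpace C.B3 := hB.completeSpace_coe
  exact C.B3.orthogonal_orthogonal.le hu.u3_mem_orthogonal_H3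

end IsSolution

namespace Discretization

variable {D : C.Discretization}

attribute [local instance] finite_V1 finite_V2

namespace IsSolution

theorem u2_mem_orthogonal_H2h (hh : D.IsSolution ν f₂ f₃ uh) : (uh.u2 : W₂) ∈ D.H2hᗮ := by
  refine (Submodule.mem_orthogonal' _ _).2 fun χ hχ => ?_
  simpa [B₀] using hh.2.2.2.2.2 ⟨0, 0, 0, χ, 0⟩ D.V1.zero_mem D.V2.zero_mem D.V3.zero_mem hχ
    D.H3h.zero_mem

theorem u3_mem_B3h (hh : D.IsSolution ν f₂ f₃ uh) : uh.u3 ∈ D.B3h := by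
  refine mem_of_forall_orthogonal_inf_inner_eq_zero (𝕜 := ℝ) B3h_le_V3 hh.2.2.1 fun χ hχ => ?_
  simpa [B₀] using hh.2.2.2.2.2 ⟨0, 0, 0, 0, χ⟩ D.V1.zero_mem D.V2.zero_mem D.V3.zero_mem
    D.H2h.zero_mem hχ.symm

theorem inner_φ2_error_d1 (hu : C.IsSolution ν f₂ f₃ u) (hh : D.IsSolution ν f₂ f₃ uh)
    {v : C.d1.domain} (hv : v ∈ D.V1) : ⟪u.φ2 - uh.φ2, C.d1 v⟫_ℝ = 0 := by
  have hu_zero : ⟪C.d1 v, u.φ2⟫_ℝ = 0 := hu.1.2 _ ⟨v, rfl⟩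
  have huh_zero : ⟪C.d1 v, uh.φ2⟫_ℝ = 0 := hh.2.2.2.1.2 _ ⟨v, hv, rfl⟩
  rw [real_inner_comm, inner_sub_right, hu_zero, huh_zero, sub_zero]

theorem inner_φ3_error_d2 (hu : C.IsSolution ν f₂ f₃ u) (hh : D.IsSolution ν f₂ f₃ uh)
    {v : C.d2.domain} (hv : v ∈ D.V2) : ⟪u.φ3 - uh.φ3, C.d2 v⟫_ℝ = 0 := by
  have hu_zero : ⟪C.d2 v, u.φ3⟫_ℝ = 0 := hu.2.1 _ ⟨v, rfl⟩
  have huh_zero : ⟪C.d2 v, uh.φ3⟫_ℝ = 0 := hh.2.2.2.2.1.2 _ ⟨v, hv, rfl⟩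
  rw [real_inner_comm, inner_sub_right, hu_zero, huh_zero, sub_zero]

theorem B₀_eq_B₀ (hu : C.IsSolution ν f₂ f₃ u) (hh : D.IsSolution ν f₂ f₃ uh) {v₁ : C.d1.domain}
    {v₂ : C.d2.domain} {v₃ : W₃} (hv₁ : v₁ ∈ D.V1) (hv₂ : v₂ ∈ D.V2) (hv₃ : v₃ ∈ D.V3) :
    C.B₀ ν u ⟨v₁, v₂, v₃, 0, 0⟩ = C.B₀ ν uh ⟨v₁, v₂, v₃, 0, 0⟩ :=
  (hu.2.2 _ C.H2.zero_mem C.H3.zero_mem).trans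
    (hh.2.2.2.2.2 ⟨v₁, v₂, v₃, 0, 0⟩ hv₁ hv₂ hv₃ D.H2h.zero_mem D.H3h.zero_mem).symm

theorem inner_u1_error (hu : C.IsSolution ν f₂ f₃ u) (hh : D.IsSolution ν f₂ f₃ uh)
    {v : C.d1.domain} (hv : v ∈ D.V1) : ⟪u.u1 - uh.u1, v⟫_ℝ = ⟪u.u2 - uh.u2, C.d1V v⟫_ℝ := by
  have h := B₀_eq_B₀ hu hh hv D.V2.zero_mem D.V3.zero_mem
  simp only [B₀, ZeroMemClass.coe_zero, inner_zero_right, mul_zero, add_zero,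
    LinearPMap.map_zero, sub_zero] at h
  rw [inner_sub_left, inner_sub_left]
  exact sub_eq_sub_iff_sub_eq_sub.1 h

theorem inner_u2_error (hu : C.IsSolution ν f₂ f₃ u) (hh : D.IsSolution ν f₂ f₃ uh)
    {v : C.d2.domain} (hv : v ∈ D.V2) :
    ⟪u.u3 - uh.u3, C.d2 v⟫_ℝ =
      ν * ⟪C.d1 (u.u1 - uh.u1), (v : W₂)⟫_ℝ + ⟪u.φ2 - uh.φ2, (v : W₂)⟫_ℝ := by
  have h := B₀_eq_B₀ hu hh D.V1.zero_mem hv D.V3.zero_mem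
  simp only [B₀, ZeroMemClass.coe_zero, inner_zero_right, LinearPMap.map_zero, sub_self, zero_add,
    add_zero] at h
  rw [LinearPMap.map_sub, inner_sub_left, inner_sub_left, inner_sub_left]
  linarith

theorem inner_u3_error (hu : C.IsSolution ν f₂ f₃ u) (hh : D.IsSolution ν f₂ f₃ uh)
    {v : W₃} (hv : v ∈ D.V3) : ⟪C.d2 (u.u2 - uh.u2), v⟫_ℝ = -⟪u.φ3 - uh.φ3, v⟫_ℝ := by
  have h := B₀_eq_B₀ hu hh D.V1.zero_mem D.V2.zero_mem hv
  simp only [B₀, ZeroMemClass.coe_zero, inner_zero_right, LinearPMap.map_zero, sub_self, mul_zero,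
    add_zero, zero_add] at h
  rw [LinearPMap.map_sub, inner_sub_left, inner_sub_left]
  linarith

theorem inner_d1_error_d1 (hν : ν ≠ 0) (hu : C.IsSolution ν f₂ f₃ u)
    (hh : D.IsSolution ν f₂ f₃ uh) {v : C.d1.domain} (hv : v ∈ D.V1) :
    ⟪C.d1 (u.u1 - uh.u1), C.d1 v⟫_ℝ = 0 := by
  have h := inner_u2_error hu hh (D.d1_mem v hv)
  rw [d2_d1V, inner_zero_right] at h
  change 0 = ν * ⟪_, C.d1 v⟫_ℝ + ⟪_, C.d1 v⟫_ℝ at h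
  rw [inner_φ2_error_d1 hu hh hv, add_zero] at h
  exact (mul_eq_zero.1 h.symm).resolve_left hν

variable {c N : ℝ}

theorem vNorm_u1_error_le (hν : ν ≠ 0) (hc : 0 ≤ c) (hP₁ : PoincareIneqOn C.d1.toFun D.V1 c)
    (hu : C.IsSolution ν f₂ f₃ u) (hh : D.IsSolution ν f₂ f₃ uh) :
    vNorm C.d1 (u.u1 - uh.u1) ≤ (2 + 2 * c) * D.bestV1 u.u1 := by
  rw [bestV1, Real.mul_iInf_of_nonneg (by positivity)]
  refine le_ciInf fun s => ?_
  have h := hP₁.norm_sub_add_norm_map_sub_le hc le_rfl hh.1 s.2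
    (fun v hv => inner_d1_error_d1 hν hu hh hv) (fun v hv => ?_)
  · rwa [add_zero] at h
  · have hd : C.d1V v = 0 := Subtype.ext hv.2
    rw [inner_u1_error hu hh hv.1, hd, inner_zero_right, norm_zero, zero_mul]

theorem norm_inner_u2_error_le [CompleteSpace W₂] (hc : 0 ≤ c)
    (hP₁ : PoincareIneqOn C.d1.toFun D.V1 c) (hN : 0 ≤ N) (hD : D.ProjBound N)
    (hB : IsClosed (C.B2 : Set W₂)) (hu : C.IsSolution ν f₂ f₃ u)
    (hh : D.IsSolution ν f₂ f₃ uh) {z : C.d2.domain} (hz : z ∈ D.Z2h) :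
    ‖⟪u.u2 - uh.u2, z⟫_ℝ‖ ≤
      (c * ‖u.u1 - uh.u1‖ + (1 + N) * D.E2 (C.PB2 u.u2) * D.mu) * ‖z‖ := by
  have hE := D.E2_nonneg (C.PB2 u.u2)
  have hμ := D.mu_nonneg
  refine norm_inner_le_of_le_of_orthogonal_inf B2h_le_Z2h (by positivity) (by positivity) ?_ ?_ hz
  · rintro _ ⟨v, hv, rfl⟩
    obtain ⟨w, hw, hwv, hw_le⟩ := hP₁.exists_map_eq_norm_le hv
    have hdw : C.d1V w = C.d1V v := Subtype.ext hwv
    calc ‖⟪u.u2 - uh.u2, C.d1V v⟫_ℝ‖ = ‖⟪u.u1 - uh.u1, w⟫_ℝ‖ := by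
          rw [inner_u1_error hu hh hw, hdw]
      _ ≤ ‖u.u1 - uh.u1‖ * ‖w‖ := norm_inner_le_norm _ _
      _ ≤ ‖u.u1 - uh.u1‖ * (c * ‖C.d1V v‖) := by gcongr; exact hw_le
      _ = c * ‖u.u1 - uh.u1‖ * ‖C.d1V v‖ := by ring
  · intro r hr
    obtain ⟨a, ha⟩ := exists_d1_eq_PB2 hB (u.u2 : W₂)
    have hinner : ⟪u.u2 - uh.u2, r⟫_ℝ = ⟪C.d1V a, r⟫_ℝ := by
      have huh : ⟪uh.u2, r⟫_ℝ = 0 :=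
        (Submodule.mem_orthogonal' _ _).1 hh.u2_mem_orthogonal_H2h _ (coe_mem_H2h_iff.2 hr)
      rw [inner_sub_left, huh, sub_zero]
      exact (inner_eq_inner_PB2 hB hu.u2_mem_orthogonal_H2 hr.2.2).trans (ha ▸ rfl)
    rw [hinner, ← ha]
    exact hD.norm_inner_d1V_le hN hB a hr

theorem vNorm_u2_error_le [CompleteSpace W₂] (hc : 0 ≤ c)
    (hP₁ : PoincareIneqOn C.d1.toFun D.V1 c) (hP₂ : PoincareIneqOn C.d2.toFun D.V2 c)
    (hN : 0 ≤ N) (hD : D.ProjBound N) (hB : IsClosed (C.B2 : Set W₂))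
    (hu : C.IsSolution ν f₂ f₃ u) (hh : D.IsSolution ν f₂ f₃ uh) :
    vNorm C.d2 (u.u2 - uh.u2) ≤ (2 + 2 * c) * D.bestV2 u.u2 +
      (c * ‖u.u1 - uh.u1‖ + (1 + N) * D.E2 (C.PB2 u.u2) * D.mu) := by
  have hE := D.E2_nonneg (C.PB2 u.u2)
  have hμ := D.mu_nonneg
  refine le_mul_iInf_add (by positivity) fun s => ?_
  refine hP₂.norm_sub_add_norm_map_sub_le hc (by positivity) hh.2.1 s.2 (fun v hv => ?_)
    fun z hz => norm_inner_u2_error_le hc hP₁ hN hD hB hu hh hz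
  exact (inner_u3_error hu hh (D.d2_mem v hv)).trans (by rw [inner_φ3_error_d2 hu hh hv, neg_zero])

theorem norm_φ2_error_le (hN : 0 ≤ N) (hD : D.ProjBound N) (hu : C.IsSolution ν f₂ f₃ u)
    (hh : D.IsSolution ν f₂ f₃ uh) :
    ‖u.φ2 - uh.φ2‖ ≤ 2 * ((1 + N) * D.E2 u.φ2) + |ν| * ‖C.d1 (u.u1 - uh.u1)‖ := by
  obtain ⟨p, hp⟩ := exists_coe_eq_of_mem_H2 hu.1
  obtain ⟨q, hq⟩ := exists_coe_eq_of_mem_H2h hh.2.2.2.1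
  have hdp : C.d2 p = 0 := (coe_mem_H2_iff.1 (hp ▸ hu.1)).1
  have hqZ : q ∈ D.Z2h := (coe_mem_H2h_iff.1 (hq ▸ hh.2.2.2.1)).2
  have hπpZ : D.π2 p ∈ D.Z2h := ⟨D.π2_mem p, (D.d2_π2 p).trans (by rw [hdp, map_zero])⟩
  have hclose : ‖p - q‖ ≤ 2 * ‖p - D.π2 p‖ + |ν| * ‖C.d1 (u.u1 - uh.u1)‖ := by
    refine norm_sub_le_of_norm_inner_le (𝕜 := ℝ) (by positivity) (D.Z2h.sub_mem hqZ hπpZ)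
      fun z hz => ?_
    have hinner : ⟪p - q, z⟫_ℝ = -(ν * ⟪C.d1 (u.u1 - uh.u1), (z : W₂)⟫_ℝ) := by
      have h := inner_u2_error hu hh hz.1
      rw [show C.d2 z = 0 from hz.2, inner_zero_right, ← hp, ← hq] at h
      exact eq_neg_of_add_eq_zero_right h.symm
    rw [hinner, norm_neg, norm_mul, Real.norm_eq_abs, mul_assoc]
    gcongr
    exact norm_inner_le_norm _ _
  rw [← hp, ← hq]
  exact hclose.trans (by gcongr; exact hD.norm_sub_π2_le_E2 hN p)

theorem norm_φ3_error_le (hu : C.IsSolution ν f₂ f₃ u) (hh : D.IsSolution ν f₂ f₃ uh) :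
    ‖u.φ3 - uh.φ3‖ ≤ 2 * D.E3 u.φ3 + ‖C.d2 (u.u2 - uh.u2)‖ := by
  refine le_mul_iInf_add zero_le_two fun s => ?_
  refine norm_sub_le_of_norm_inner_le (𝕜 := ℝ) (norm_nonneg _)
    (D.V3.sub_mem hh.2.2.2.2.1.1 s.2) fun z hz => ?_
  rw [← norm_neg, ← inner_u3_error hu hh hz]
  exact norm_inner_le_norm _ _

theorem norm_u3_error_le [CompleteSpace W₃] (hc : 0 ≤ c) (hP₂ : PoincareIneqOn C.d2.toFun D.V2 c)
    (hN : 0 ≤ N) (hD : D.ProjBound N) (hB : IsClosed (C.B3 : Set W₃))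
    (hu : C.IsSolution ν f₂ f₃ u) (hh : D.IsSolution ν f₂ f₃ uh) :
    ‖u.u3 - uh.u3‖ ≤ 2 * ((1 + N) * D.E3 u.u3) +
      c * (|ν| * ‖C.d1 (u.u1 - uh.u1)‖ + ‖u.φ2 - uh.φ2‖) := by
  obtain ⟨w, hw⟩ := hu.exists_d2_eq_u3 hB
  have hπ : D.π3 u.u3 ∈ D.B3h := ⟨D.π2 w, D.π2_mem w, (D.d2_π2 w).trans (by rw [hw])⟩
  refine (norm_sub_le_of_norm_inner_le (𝕜 := ℝ) (by positivity) (D.B3h.sub_mem hh.u3_mem_B3h hπ)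
    ?_).trans (add_le_add_left (by gcongr; exact hD.norm_sub_π3_le_E3 hN u.u3) _)
  rintro _ ⟨v, hv, rfl⟩
  obtain ⟨z, hz, hzv, hz_le⟩ := hP₂.exists_map_eq_norm_le hv
  calc ‖⟪u.u3 - uh.u3, C.d2.toFun v⟫_ℝ‖
      = ‖ν * ⟪C.d1 (u.u1 - uh.u1), (z : W₂)⟫_ℝ + ⟪u.φ2 - uh.φ2, (z : W₂)⟫_ℝ‖ := by
        rw [← hzv]
        exact congrArg _ (inner_u2_error hu hh hz)
    _ ≤ |ν| * (‖C.d1 (u.u1 - uh.u1)‖ * ‖z‖) + ‖u.φ2 - uh.φ2‖ * ‖z‖ := by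
        refine (norm_add_le _ _).trans (add_le_add ?_ (norm_inner_le_norm _ _))
        rw [norm_mul, Real.norm_eq_abs]
        gcongr
        exact norm_inner_le_norm _ _
    _ = (|ν| * ‖C.d1 (u.u1 - uh.u1)‖ + ‖u.φ2 - uh.φ2‖) * ‖z‖ := by ring
    _ ≤ (|ν| * ‖C.d1 (u.u1 - uh.u1)‖ + ‖u.φ2 - uh.φ2‖) * (c * ‖C.d2.toFun v‖) := by gcongr
    _ = c * (|ν| * ‖C.d1 (u.u1 - uh.u1)‖ + ‖u.φ2 - uh.φ2‖) * ‖C.d2.toFun v‖ := by ring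

theorem error_le_weighted_sum [CompleteSpace W₂] [CompleteSpace W₃] (hν : ν ≠ 0) (hc : 0 ≤ c)
    (hP₁ : PoincareIneqOn C.d1.toFun D.V1 c) (hP₂ : PoincareIneqOn C.d2.toFun D.V2 c)
    (hN : 0 ≤ N) (hD : D.ProjBound N) (hB₂ : IsClosed (C.B2 : Set W₂))
    (hB₃ : IsClosed (C.B3 : Set W₃)) (hu : C.IsSolution ν f₂ f₃ u)
    (hh : D.IsSolution ν f₂ f₃ uh) :
    (vNorm C.d1 (u.u1 - uh.u1) + vNorm C.d2 (u.u2 - uh.u2) + ‖u.u3 - uh.u3‖)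
        + (‖u.φ2 - uh.φ2‖ + ‖u.φ3 - uh.φ3‖)
      ≤ (1 + 2 * c) * (1 + |ν|) * (2 + 2 * c) * D.bestV1 u.u1 + 2 * (2 + 2 * c) * D.bestV2 u.u2
          + 2 * (1 + N) * D.E3 u.u3 + 2 * (1 + N) * (1 + c) * D.E2 u.φ2 + 2 * D.E3 u.φ3
          + 2 * (1 + N) * (D.mu * D.E2 (C.PB2 u.u2)) := by
  have hvNorm₁ : vNorm C.d1 (u.u1 - uh.u1) = ‖u.u1 - uh.u1‖ + ‖C.d1 (u.u1 - uh.u1)‖ := rfl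
  have hvNorm₂ : vNorm C.d2 (u.u2 - uh.u2) = ‖u.u2 - uh.u2‖ + ‖C.d2 (u.u2 - uh.u2)‖ := rfl
  have hu₁ := vNorm_u1_error_le hν hc hP₁ hu hh
  have hu₂ := vNorm_u2_error_le hc hP₁ hP₂ hN hD hB₂ hu hh
  have hu₃ := norm_u3_error_le hc hP₂ hN hD hB₃ hu hh
  have hφ₂ := norm_φ2_error_le hN hD hu hh
  have hφ₃ := norm_φ3_error_le hu hh
  have hu₁_weighted : (1 + 2 * c) * ‖u.u1 - uh.u1‖
      + (1 + (1 + 2 * c) * |ν|) * ‖C.d1 (u.u1 - uh.u1)‖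
        ≤ (1 + 2 * c) * (1 + |ν|) * ((2 + 2 * c) * D.bestV1 u.u1) := by
    refine le_trans ?_ (mul_le_mul_of_nonneg_left hu₁ (by positivity))
    rw [hvNorm₁, mul_add]
    gcongr
    · exact le_mul_of_one_le_right (by positivity) (le_add_of_nonneg_right (abs_nonneg ν))
    · linarith
  have hφ₂_weighted := mul_le_mul_of_nonneg_left hφ₂ (add_nonneg zero_le_one hc)
  rw [hvNorm₁] at hu₁ ⊢
  rw [hvNorm₂] at hu₂ ⊢
  linarith [norm_nonneg (u.u2 - uh.u2)]

theorem error_le [CompleteSpace W₂] [CompleteSpace W₃] (hν : ν ≠ 0) (hc : 0 ≤ c)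
    (hP₁ : PoincareIneqOn C.d1.toFun D.V1 c) (hP₂ : PoincareIneqOn C.d2.toFun D.V2 c)
    (hN : 0 ≤ N) (hD : D.ProjBound N) (hB₂ : IsClosed (C.B2 : Set W₂))
    (hB₃ : IsClosed (C.B3 : Set W₃)) (hu : C.IsSolution ν f₂ f₃ u)
    (hh : D.IsSolution ν f₂ f₃ uh) :
    (vNorm C.d1 (u.u1 - uh.u1) + vNorm C.d2 (u.u2 - uh.u2) + ‖u.u3 - uh.u3‖)
        + (‖u.φ2 - uh.φ2‖ + ‖u.φ3 - uh.φ3‖)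
      ≤ 4 * (1 + N) * (1 + c) ^ 2 * (1 + |ν|) * (D.bestV1 u.u1 + D.bestV2 u.u2 + D.E3 u.u3
          + D.E2 u.φ2 + D.E3 u.φ3 + D.mu * D.E2 (C.PB2 u.u2)) := by
  refine (error_le_weighted_sum hν hc hP₁ hP₂ hN hD hB₂ hB₃ hu hh).trans ?_
  have hbest₁ := D.bestV1_nonneg u.u1
  have hbest₂ := D.bestV2_nonneg u.u2
  have hE_u₃ := D.E3_nonneg u.u3
  have hE_φ₂ := D.E2_nonneg u.φ2
  have hE_φ₃ := D.E3_nonneg u.φ3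
  have hμE := mul_nonneg D.mu_nonneg (D.E2_nonneg (C.PB2 u.u2))
  simp only [mul_add (4 * (1 + N) * (1 + c) ^ 2 * (1 + |ν|))]
  gcongr ?_ * _ + ?_ * _ + ?_ * _ + ?_ * _ + ?_ * _ + ?_ * _ <;>
    (refine le_of_sub_nonneg ?_; ring_nf; positivity)

end IsSolution

end Discretization

end HilbertComplex

end ErrorEstimates

theorem mainTheorem7_general (ν κ M : ℝ) (hν : ν ≠ 0) :
    ∃ K : ℝ, 0 < K ∧
      ∀ {W₀ W₁ W₂ W₃ : Type*}
        [NormedAddCommGroup W₀] [InnerProductSpace ℝ W₀]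
        [NormedAddCommGroup W₁] [InnerProductSpace ℝ W₁] [CompleteSpace W₁]
        [NormedAddCommGroup W₂] [InnerProductSpace ℝ W₂] [CompleteSpace W₂]
        [NormedAddCommGroup W₃] [InnerProductSpace ℝ W₃] [CompleteSpace W₃],
      ∀ C : HilbertComplex W₀ W₁ W₂ W₃, PoincareIneq C.d1 κ → PoincareIneq C.d2 κ →
      ∀ D : C.Discretization, D.ProjBound M →
      ∀ (f₂ : W₂) (f₃ : W₃) (u uh : C.MixedTuple),
        C.IsSolution ν f₂ f₃ u → D.IsSolution ν f₂ f₃ uh →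
        (vNorm C.d1 (u.u1 - uh.u1) + vNorm C.d2 (u.u2 - uh.u2) + ‖u.u3 - uh.u3‖)
            + (‖u.φ2 - uh.φ2‖ + ‖u.φ3 - uh.φ3‖)
          ≤ K * (D.bestV1 u.u1 + D.bestV2 u.u2 + D.E3 u.u3 + D.E2 u.φ2 + D.E3 u.φ3
              + D.mu * D.E2 (C.PB2 u.u2)) := by
  refine ⟨4 * (1 + |M|) * (1 + |M| * |κ|) ^ 2 * (1 + |ν|), by positivity, ?_⟩
  intro W₀ W₁ W₂ W₃ _ _ _ _ _ _ _ _ _ _ _ C hP₁ hP₂ D hD f₂ f₃ u uh hu hh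
  have hM := abs_nonneg M
  have hD' := hD.mono (le_abs_self M)
  exact HilbertComplex.Discretization.IsSolution.error_le hν (by positivity)
    (hD'.poincareIneqOn_d1 hM (hP₁.mono (le_abs_self κ)))
    (hD'.poincareIneqOn_d2 hM (hP₂.mono (le_abs_self κ))) hM hD'
    (hP₁.isClosed_range C.closed_d1) (hP₂.isClosed_range C.closed_d2) hu hh

theorem mainTheorem7 (ν κ M : ℝ) (hν : 0 < ν) :
    ∃ K : ℝ, 0 < K ∧
      ∀ Ω : Set R3, IsOpen Ω → IsConnected Ω → Bornology.IsBounded Ω →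
      ∀ C : HilbertComplex (L2s Ω) (L2v Ω) (L2v Ω) (L2s Ω),
        IsDeRham Ω C → C.CompactnessProperty → C.poincareConst ≤ κ →
      ∀ D : C.Discretization, D.ProjBound M →
      ∀ (f₂ : L2v Ω) (f₃ : L2s Ω) (u uh : C.MixedTuple),
        C.IsSolution ν f₂ f₃ u → D.IsSolution ν f₂ f₃ uh →
        (vNorm C.d1 (u.u1 - uh.u1) + vNorm C.d2 (u.u2 - uh.u2) + ‖u.u3 - uh.u3‖)
            + (‖u.φ2 - uh.φ2‖ + ‖u.φ3 - uh.φ3‖)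
          ≤ K * (D.bestV1 u.u1 + D.bestV2 u.u2 + D.E3 u.u3 + D.E2 u.φ2 + D.E3 u.φ3
              + D.mu * (D.E2 (C.PB2 u.u2) + D.E3 (C.PB3 u.u3))) := by
  obtain ⟨K, hK, hbound⟩ := mainTheorem7_general ν κ M hν.ne'
  refine ⟨K, hK, fun Ω _ _ _ C _ hC hκ D hD f₂ f₃ u uh hu hh => ?_⟩
  obtain ⟨hP₁, hP₂⟩ := hC.poincareIneq hκ
  refine (hbound C hP₁ hP₂ D hD f₂ f₃ u uh hu hh).trans ?_
  have hμ := D.mu_nonneg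
  gcongr
  exact le_add_of_nonneg_right (D.E3_nonneg _)
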